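/- **Notation.** For an integer $k\ge 1$ and $\rho\in\mathbb R$ let $D^{(k,\rho)}$ be the unitary principal series representation of $\mathrm{SL}(2,\mathbb C)$ on $\mathcal H_{(k,\rho)}=L^2(\mathbb C,\mathrm d^2z)$, $$\big(D^{(k,\rho)}(g)f\big)(z)=\chi(bz+d)\,f\!\left(\frac{az+c}{bz+d}\right),\qquad g=\begin{pmatrix}a&b\\c&d\end{pmatrix},\qquad \chi(w)=|w|^{\mathrm i\rho-2}\left(\frac{\bar w}{|w|}\right)^{k}.$$ Let $\mathcal H_k\subset\mathcal H_{(k,\rho)}$ be the subspace carrying the lowest $\mathrm{SU}(2)$ irrep, of spin $k/2$ and dimension $d_k=k+1$; it is spanned by the functions $\bar z^{m}(1+|z|^2)^{\mathrm i\rho/2-1-k/2}$, $0\le m\le k$. Let $P_k$ be the orthogonal projection of $\mathcal H_{(k,\rho)}$ onto $\mathcal H_k$. Let $h$ be an internal face of a 2-complex, that is, a face with a closed oriented boundary cycle $\partial h$, which passes $N\ge1$ vertices. Let $g_{ve}\in\mathrm{SL}(2,\mathbb C)$ be group elements attached to the half-edges $(v,e)$ of the complex. At each vertex $v$ of $\partial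 h$ let $e$ and $e'$ be the incoming and the outgoing edge of the cycle, and call $g_{ve}^{-1}g_{ve'}$ the wedge holonomy at $v$. The face amplitude is $$\tau_k^{(h)}(g_h)=d_k\,\mathrm{Tr}_{\mathcal H_{(k,\rho)}}\Big[\overrightarrow{\prod_{v\in\partial h}}P_k\,D^{(k,\rho)}\big(g_{ve}^{-1}g_{ve'}\big)\,P_k\Big],$$ where the product is ordered from left to right along the cycle. **Theorem.** For every integer $k\ge1$, every $\rho\in\mathbb R$ (in particular for $\rho=\gamma(k+2)$ with any $\gamma\in\mathbb R$), every internal face $h$ and every choice of the $g_{ve}\in\mathrm{SL}(2,\mathbb C)$, $$\big|\tau_k^{(h)}(g_h)\big|\le d_k^2 .$$ Equality holds if and only if $g_{ve}^{-1}g_{ve'}\in\mathrm{SU}(2)$ at every vertex $v$ of $\partial h$ and $\overrightarrow{\prod}_{v\in\partial h}\,g_{ve}^{-1}g_{ve'}=\pm\mathbb I$. -/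

import Mathlib

open MeasureTheory

namespace Spinfoam

/-- The group `SL(2,ℂ)`. -/
abbrev SL2C : Type := Matrix.SpecialLinearGroup (Fin 2) ℂ

/-- The Hilbert space `L²(ℂ, d²z)`, the carrier space of all principal series representations of
`SL(2,ℂ)` in the noncompact picture. -/
abbrev L2C : Type := Lp ℂ 2 (volume : Measure ℂ)

/-! ### The unitary principal series -/

/-- The second component of the row vector `(z, 1) g`. -/
noncomputable def denom (g : SL2C) (z : ℂ) : ℂ := g.1 0 1 * z + g.1 1 1

/-- The fractional linear map `z ↦ (g₀₀ z + g₁₀) / (g₀₁ z + g₁₁)`, which is the action of `g` on the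
row vector `(z, 1)` in the affine coordinate. -/
noncomputable def moebius (g : SL2C) (z : ℂ) : ℂ := (g.1 0 0 * z + g.1 1 0) / denom g z

/-- The character `w ↦ w ^ (-k/2 + iρ/2 - 1) * (conj w) ^ (k/2 + iρ/2 - 1)` of `ℂˣ`, written
without a choice of branch as `|w| ^ (iρ - 2) * (conj w / |w|) ^ k`. -/
noncomputable def character (k : ℕ) (ρ : ℝ) (w : ℂ) : ℂ :=
  (‖w‖ : ℂ) ^ (Complex.I * ρ - 2) * ((starRingEnd ℂ) w / ‖w‖) ^ k

/-- The action of `g` on functions on `ℂ` in the representation `(k, ρ)`: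
`(g f)(z) = χ(g₀₁ z + g₁₁) f((g₀₀ z + g₁₀) / (g₀₁ z + g₁₁))`. -/
noncomputable def actFun (k : ℕ) (ρ : ℝ) (g : SL2C) (f : ℂ → ℂ) (z : ℂ) : ℂ :=
  character k ρ (denom g z) * f (moebius g z)

theorem det_eq (g : SL2C) : g.1 0 0 * g.1 1 1 - g.1 0 1 * g.1 1 0 = 1 := by
  have h := g.2
  rwa [Matrix.det_fin_two] at h

theorem measurable_denom (g : SL2C) : Measurable (denom g) := by
  unfold denom; fun_prop

theorem measurable_moebius (g : SL2C) : Measurable (moebius g) := by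
  unfold moebius denom; fun_prop

theorem measurable_character (k : ℕ) (ρ : ℝ) : Measurable (character k ρ) := by
  unfold character
  have h : Measurable (fun w : ℂ => (starRingEnd ℂ) w) := Complex.continuous_conj.measurable
  fun_prop

theorem norm_character (k : ℕ) (ρ : ℝ) {w : ℂ} (hw : w ≠ 0) :
    ‖character k ρ w‖ = ‖w‖⁻¹ ^ 2 := by
  have hw' : 0 < ‖w‖ := norm_pos_iff.mpr hw
  rw [character, norm_mul, norm_pow, Complex.norm_cpow_eq_rpow_re_of_pos hw']
  simp [hw'.ne', Real.rpow_neg hw'.le]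

theorem character_mul (k : ℕ) (ρ : ℝ) (w w' : ℂ) :
    character k ρ (w * w') = character k ρ w * character k ρ w' := by
  have h : (((‖w‖ * ‖w'‖ : ℝ) : ℂ)) ^ (Complex.I * ρ - 2)
      = (‖w‖ : ℂ) ^ (Complex.I * ρ - 2) * (‖w'‖ : ℂ) ^ (Complex.I * ρ - 2) := by
    rw [Complex.ofReal_mul, Complex.mul_cpow_ofReal_nonneg (norm_nonneg _) (norm_nonneg _)]
  rw [character, character, character, norm_mul, h, map_mul, Complex.ofReal_mul, mul_div_mul_comm,
    mul_pow]
  ring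

/-- The points which `moebius g` does not send to infinity. -/
def regular (g : SL2C) : Set ℂ := {z | denom g z ≠ 0}

theorem volume_compl_of_affine {b d : ℂ} (h : b ≠ 0 ∨ d ≠ 0) :
    volume {z : ℂ | b * z + d = 0} = 0 := by
  apply Set.Subsingleton.measure_zero
  intro z hz w hw
  simp only [Set.mem_ofPred_eq] at hz hw
  by_cases hb : b = 0
  · subst hb; simp_all
  · exact mul_left_cancel₀ hb (by linear_combination hz - hw)

theorem ae_regular (g : SL2C) : ∀ᵐ z ∂(volume : Measure ℂ), denom g z ≠ 0 := by
  rw [ae_iff]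
  simp only [not_not]
  apply volume_compl_of_affine
  by_contra! h
  have := det_eq g
  simp [h.1, h.2] at this

theorem measurableSet_regular (g : SL2C) : MeasurableSet (regular g) :=
  (measurable_denom g) (measurableSet_singleton (0 : ℂ)).compl

theorem denom_mul (g h : SL2C) {z : ℂ} (hz : denom g z ≠ 0) :
    denom (g * h) z = denom g z * denom h (moebius g z) := by
  simp only [denom, moebius] at *
  simp only [Matrix.SpecialLinearGroup.coe_mul, Matrix.mul_apply, Fin.sum_univ_two]
  field_simp
  ring

theorem moebius_mul (g h : SL2C) {z : ℂ} (hz : denom g z ≠ 0) :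
    moebius (g * h) z = moebius h (moebius g z) := by
  rw [moebius, denom_mul g h hz, moebius.eq_1 h, ← div_div]
  congr 1
  simp only [denom, moebius] at *
  simp only [Matrix.SpecialLinearGroup.coe_mul, Matrix.mul_apply, Fin.sum_univ_two]
  field_simp
  ring

theorem denom_one (z : ℂ) : denom 1 z = 1 := by simp [denom]

theorem moebius_one (z : ℂ) : moebius 1 z = z := by simp [moebius, denom]

theorem moebius_inv_moebius (g : SL2C) {z : ℂ} (hz : denom g z ≠ 0) :
    moebius g⁻¹ (moebius g z) = z := by
  rw [← moebius_mul g g⁻¹ hz, mul_inv_cancel, moebius_one]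

theorem denom_inv_moebius (g : SL2C) {z : ℂ} (hz : denom g z ≠ 0) :
    denom g⁻¹ (moebius g z) ≠ 0 := by
  have h := denom_mul g g⁻¹ hz
  rw [mul_inv_cancel, denom_one] at h
  intro h0
  simp [h0] at h

theorem image_regular (g : SL2C) : moebius g '' regular g = regular g⁻¹ := by
  ext w
  constructor
  · rintro ⟨z, hz, rfl⟩
    exact denom_inv_moebius g hz
  · intro hw
    refine ⟨moebius g⁻¹ w, ?_, ?_⟩
    · simpa [regular] using denom_inv_moebius g⁻¹ hw
    · simpa using moebius_inv_moebius g⁻¹ hw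

theorem injOn_moebius (g : SL2C) : Set.InjOn (moebius g) (regular g) := by
  intro z hz w hw h
  rw [← moebius_inv_moebius g hz, ← moebius_inv_moebius g hw, h]

theorem hasDerivAt_moebius (g : SL2C) {z : ℂ} (hz : denom g z ≠ 0) :
    HasDerivAt (moebius g) ((denom g z)⁻¹ ^ 2) z := by
  have hn : HasDerivAt (fun z => g.1 0 0 * z + g.1 1 0) (g.1 0 0) z := by
    simpa using ((hasDerivAt_id z).const_mul (g.1 0 0)).add_const (g.1 1 0)
  have hd : HasDerivAt (denom g) (g.1 0 1) z := by
    have h := ((hasDerivAt_id z).const_mul (g.1 0 1)).add_const (g.1 1 1)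
    rwa [mul_one] at h
  refine (hn.div hd hz).congr_deriv ?_
  rw [inv_pow, div_eq_iff (pow_ne_zero 2 hz), inv_mul_cancel₀ (pow_ne_zero 2 hz)]
  simp only [denom]
  linear_combination det_eq g

/-- The change of variables formula for the fractional linear map. -/
theorem lintegral_moebius (g : SL2C) (F : ℂ → ENNReal) :
    ∫⁻ z, ENNReal.ofReal (‖denom g z‖⁻¹ ^ 4) * F (moebius g z) = ∫⁻ z, F z := by
  have hder : ∀ z ∈ regular g, HasFDerivWithinAt (moebius g)
      ((ContinuousLinearMap.toSpanSingleton ℂ ((denom g z)⁻¹ ^ 2)).restrictScalars ℝ)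
      (regular g) z := fun z hz =>
    ((hasDerivAt_moebius g hz).hasFDerivAt.restrictScalars ℝ).hasFDerivWithinAt
  have key := lintegral_image_eq_lintegral_abs_det_fderiv_mul volume (measurableSet_regular g) hder
    (injOn_moebius g) F
  have hfull : ∀ g : SL2C, (volume : Measure ℂ).restrict (regular g) = volume := fun g =>
    Measure.restrict_eq_self_of_ae_mem (ae_regular g)
  rw [image_regular, hfull, hfull] at key
  rw [key]
  apply lintegral_congr
  intro z
  congr 2
  have hdet : ∀ c : ℂ, ((ContinuousLinearMap.toSpanSingleton ℂ c).restrictScalars ℝ).det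
      = ‖c‖ ^ 2 := by
    intro c
    rw [ContinuousLinearMap.det, ← LinearMap.det_toMatrix Complex.basisOneI, Matrix.det_fin_two]
    simp [LinearMap.toMatrix_apply, Complex.sq_norm, Complex.normSq_apply]
  rw [hdet, abs_of_nonneg (by positivity)]
  simp only [norm_pow, norm_inv]
  ring

theorem quasiMeasurePreserving_moebius (g : SL2C) :
    Measure.QuasiMeasurePreserving (moebius g) (volume : Measure ℂ) volume := by
  refine ⟨measurable_moebius g, ?_⟩
  intro s hs
  obtain ⟨t, hst, ht, ht0⟩ := exists_measurable_superset_of_null hs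
  refine measure_mono_null hst ?_
  rw [Measure.map_apply (measurable_moebius g) ht]
  have h := lintegral_moebius g (t.indicator 1)
  rw [lintegral_indicator_one ht, ht0, lintegral_eq_zero_iff] at h
  · rw [measure_eq_zero_iff_ae_notMem]
    filter_upwards [h, ae_regular g] with z hz hzr hzt
    have : 0 < ‖denom g z‖ := norm_pos_iff.mpr hzr
    have h1 : moebius g z ∈ t := hzt
    simp [h1] at hz
    have h4 : 0 < ‖denom g z‖ ^ 4 := by positivity
    linarith
  · have := measurable_denom g
    have h2 : Measurable (t.indicator (1 : ℂ → ENNReal)) := measurable_one.indicator ht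
    have h3 := h2.comp (measurable_moebius g)
    exact (by fun_prop : Measurable fun z => ENNReal.ofReal (‖denom g z‖⁻¹ ^ 4)).mul h3

theorem actFun_congr (k : ℕ) (ρ : ℝ) (g : SL2C) {f f' : ℂ → ℂ} (h : f =ᵐ[volume] f') :
    actFun k ρ g f =ᵐ[volume] actFun k ρ g f' := by
  filter_upwards [(quasiMeasurePreserving_moebius g).ae_eq_comp h] with z hz
  simp only [Function.comp_apply] at hz
  simp only [actFun, hz]

theorem eLpNorm_actFun (k : ℕ) (ρ : ℝ) (g : SL2C) (f : ℂ → ℂ) :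
    eLpNorm (actFun k ρ g f) 2 volume = eLpNorm f 2 volume := by
  rw [eLpNorm_eq_lintegral_rpow_enorm_toReal two_ne_zero ENNReal.ofNat_ne_top,
    eLpNorm_eq_lintegral_rpow_enorm_toReal two_ne_zero ENNReal.ofNat_ne_top]
  congr 1
  rw [← lintegral_moebius g (fun z => ‖f z‖ₑ ^ (2 : ENNReal).toReal)]
  apply lintegral_congr_ae
  filter_upwards [ae_regular g] with z hz
  rw [actFun, enorm_mul, ENNReal.mul_rpow_of_nonneg _ _ (by norm_num)]
  congr 1
  rw [← ofReal_norm, norm_character k ρ hz, ENNReal.ofReal_rpow_of_nonneg (by positivity)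
    (by norm_num)]
  congr 1
  norm_num
  ring

theorem memLp_actFun (k : ℕ) (ρ : ℝ) (g : SL2C) (f : L2C) :
    MemLp (actFun k ρ g f) 2 volume := by
  refine ⟨?_, ?_⟩
  · exact ((measurable_character k ρ).comp (measurable_denom g)).aestronglyMeasurable.mul
      ((Lp.aestronglyMeasurable f).comp_quasiMeasurePreserving (quasiMeasurePreserving_moebius g))
  · rw [eLpNorm_actFun]
    exact Lp.eLpNorm_lt_top f

/-- The operator `D^{(k,ρ)}(g)` on `L²(ℂ)`, an isometry. -/
noncomputable def actIsometry (k : ℕ) (ρ : ℝ) (g : SL2C) : L2C →ₗᵢ[ℂ] L2C where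
  toFun f := (memLp_actFun k ρ g f).toLp
  map_add' f f' := by
    rw [← MemLp.toLp_add]
    apply MemLp.toLp_congr
    refine (actFun_congr k ρ g (Lp.coeFn_add f f')).trans (Filter.Eventually.of_forall fun z => ?_)
    simp only [actFun, Pi.add_apply, mul_add]
  map_smul' c f := by
    rw [RingHom.id_apply, ← MemLp.toLp_const_smul]
    apply MemLp.toLp_congr
    refine (actFun_congr k ρ g (Lp.coeFn_smul c f)).trans (Filter.Eventually.of_forall fun z => ?_)
    simp only [actFun, Pi.smul_apply, smul_eq_mul]
    ring
  norm_map' f := by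
    change ‖(memLp_actFun k ρ g f).toLp (actFun k ρ g f)‖ = ‖f‖
    rw [Lp.norm_toLp, eLpNorm_actFun, Lp.norm_def]

theorem coeFn_actIsometry (k : ℕ) (ρ : ℝ) (g : SL2C) (f : L2C) :
    actIsometry k ρ g f =ᵐ[volume] actFun k ρ g f :=
  MemLp.coeFn_toLp (memLp_actFun k ρ g f)

theorem actIsometry_one (k : ℕ) (ρ : ℝ) : actIsometry k ρ 1 = 1 := by
  ext1 f
  apply Lp.ext
  refine (coeFn_actIsometry k ρ 1 f).trans (Filter.Eventually.of_forall fun z => ?_)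
  simp [actFun, denom_one, moebius_one, character]

theorem actIsometry_mul (k : ℕ) (ρ : ℝ) (g h : SL2C) :
    actIsometry k ρ (g * h) = actIsometry k ρ g * actIsometry k ρ h := by
  ext1 f
  apply Lp.ext
  refine (coeFn_actIsometry k ρ (g * h) f).trans ?_
  refine Filter.EventuallyEq.trans ?_ (coeFn_actIsometry k ρ g (actIsometry k ρ h f)).symm
  refine Filter.EventuallyEq.trans ?_ (actFun_congr k ρ g (coeFn_actIsometry k ρ h f)).symm
  filter_upwards [ae_regular g] with z hz
  simp only [actFun, denom_mul g h hz, moebius_mul g h hz, character_mul, mul_assoc]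

/-- The unitary principal series representation `D^{(k,ρ)}` of `SL(2,ℂ)`, as a homomorphism into
the unitary operators of `L²(ℂ)`. -/
noncomputable def principalSeries (k : ℕ) (ρ : ℝ) : SL2C →* (L2C ≃ₗᵢ[ℂ] L2C) where
  toFun g :=
    { toLinearEquiv := LinearEquiv.ofLinearMap (actIsometry k ρ g).toLinearMap
        (actIsometry k ρ g⁻¹).toLinearMap
        (by
          ext1 f
          change (actIsometry k ρ g * actIsometry k ρ g⁻¹) f = f
          rw [← actIsometry_mul, mul_inv_cancel, actIsometry_one]; rfl)
        (by
          ext1 f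
          change (actIsometry k ρ g⁻¹ * actIsometry k ρ g) f = f
          rw [← actIsometry_mul, inv_mul_cancel, actIsometry_one]; rfl)
      norm_map' := (actIsometry k ρ g).norm_map }
  map_one' := by
    ext1 f
    change actIsometry k ρ 1 f = f
    rw [actIsometry_one]; rfl
  map_mul' g h := by
    ext1 f
    change actIsometry k ρ (g * h) f = (actIsometry k ρ g * actIsometry k ρ h) f
    rw [actIsometry_mul]

/-! ### The lowest `SU(2)` subspace -/

/-- The functions `z ↦ (conj z) ^ m * (1 + |z|²) ^ (iρ/2 - 1 - k/2)`. With `0 ≤ m ≤ k` these are, in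
the noncompact picture, the homogeneous polynomials of degree `k` in the conjugates of the two
components of a unit row vector, so they span the `SU(2)` irrep of spin `k/2` in the representation
`(k, ρ)`. -/
noncomputable def lowestFun (k : ℕ) (ρ : ℝ) (m : ℕ) (z : ℂ) : ℂ :=
  (starRingEnd ℂ) z ^ m * ((1 + ‖z‖ ^ 2 : ℝ) : ℂ) ^ (Complex.I * ρ / 2 - 1 - k / 2)

theorem memLp_lowestFun (k : ℕ) (ρ : ℝ) {m : ℕ} (hm : m ≤ k) :
    MemLp (lowestFun k ρ m) 2 (volume : Measure ℂ) := by
  have hmeas : AEStronglyMeasurable (lowestFun k ρ m) (volume : Measure ℂ) := by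
    have h : Measurable (fun w : ℂ => (starRingEnd ℂ) w) := Complex.continuous_conj.measurable
    apply Measurable.aestronglyMeasurable
    unfold lowestFun
    fun_prop
  rw [memLp_two_iff_integrable_sq_norm hmeas]
  have hint : Integrable (fun z : ℂ => ((1 : ℝ) + ‖z‖ ^ 2) ^ (-(4 : ℝ) / 2)) volume :=
    integrable_rpow_neg_one_add_norm_sq (by rw [Complex.finrank_real_complex]; norm_num)
  refine hint.mono' (by fun_prop) (Filter.Eventually.of_forall fun z => ?_)
  have h1 : (0 : ℝ) < 1 + ‖z‖ ^ 2 := by positivity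
  have h2 : ‖lowestFun k ρ m z‖ = ‖z‖ ^ m * (1 + ‖z‖ ^ 2) ^ (-1 - (k : ℝ) / 2) := by
    rw [lowestFun, norm_mul, Complex.norm_cpow_eq_rpow_re_of_pos h1]
    simp
  rw [h2, Real.norm_of_nonneg (by positivity), mul_pow, ← Real.rpow_mul_natCast h1.le, ← pow_mul,
    mul_comm m 2, pow_mul]
  calc (‖z‖ ^ 2) ^ m * (1 + ‖z‖ ^ 2) ^ ((-1 - (k : ℝ) / 2) * (2 : ℕ))
      ≤ (1 + ‖z‖ ^ 2) ^ k * (1 + ‖z‖ ^ 2) ^ ((-1 - (k : ℝ) / 2) * (2 : ℕ)) := by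
        gcongr
        calc (‖z‖ ^ 2) ^ m ≤ (1 + ‖z‖ ^ 2) ^ m := by gcongr; linarith
          _ ≤ (1 + ‖z‖ ^ 2) ^ k := pow_le_pow_right₀ (by nlinarith [sq_nonneg ‖z‖]) hm
    _ = (1 + ‖z‖ ^ 2) ^ (-(4 : ℝ) / 2) := by
        rw [← Real.rpow_natCast, ← Real.rpow_add h1]
        congr 1
        push_cast
        ring

/-- The subspace `H_k ⊆ H_{(k,ρ)}` carrying the `SU(2)` irrep of the lowest spin `k/2`. -/
noncomputable def lowestSubspace (k : ℕ) (ρ : ℝ) : Submodule ℂ L2C :=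
  Submodule.span ℂ (Set.range fun m : Fin (k + 1) =>
    (memLp_lowestFun k ρ (Nat.lt_succ_iff.mp m.2)).toLp)

instance (k : ℕ) (ρ : ℝ) : FiniteDimensional ℂ (lowestSubspace k ρ) :=
  FiniteDimensional.span_of_finite ℂ (Set.finite_range _)

/-- The orthogonal projection `P_k` of `H_{(k,ρ)}` onto `H_k`. -/
noncomputable def simplicityProj (k : ℕ) (ρ : ℝ) : L2C →L[ℂ] L2C :=
  (lowestSubspace k ρ).starProjection

/-! ### The trace -/

/-- The trace `∑ᵢ ⟨bᵢ, T bᵢ⟩` of an operator of a Hilbert space, over an orthonormal basis. For the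
operators of finite rank to which it is applied here it does not depend on the basis. -/
noncomputable def hilbertTrace {E : Type*} [NormedAddCommGroup E] [InnerProductSpace ℂ E]
    [CompleteSpace E] (T : E →L[ℂ] E) : ℂ :=
  ∑' i, inner ℂ ((exists_hilbertBasis ℂ E).choose_spec.choose i)
    (T ((exists_hilbertBasis ℂ E).choose_spec.choose i))

theorem hasSum_inner_of_finite {E : Type*} [NormedAddCommGroup E] [InnerProductSpace ℂ E]
    [CompleteSpace E] {ι : Type*} (b : HilbertBasis ι ℂ E) (T : E →L[ℂ] E) (K : Submodule ℂ E)
    [FiniteDimensional ℂ K] (hT : T ∘L K.starProjection = T) :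
    HasSum (fun i => inner ℂ (b i) (T (b i)))
      (∑ j, inner ℂ (stdOrthonormalBasis ℂ K j : E) (T (stdOrthonormalBasis ℂ K j))) := by
  let e := stdOrthonormalBasis ℂ K
  have hexp : ∀ x : E, T x = ∑ j, inner ℂ (e j : E) x • T (e j) := by
    intro x
    have h : K.starProjection x = ∑ j, inner ℂ (e j : E) x • (e j : E) := by
      rw [e.starProjection_eq_sum_rankOne]
      simp
    conv_lhs => rw [← hT]
    simp [h]
  have : (fun i => inner ℂ (b i) (T (b i)))
      = fun i => ∑ j, inner ℂ (e j : E) (b i) * inner ℂ (b i) (T (e j)) := by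
    funext i
    conv_lhs => rw [hexp]
    rw [inner_sum]
    simp only [inner_smul_right]
  rw [this]
  exact hasSum_sum fun j _ => b.hasSum_inner_mul_inner _ _

/-- For an operator that vanishes on the orthogonal complement of a finite-dimensional subspace,
the sum that defines the trace converges, to the same value for every orthonormal basis. -/
theorem hasSum_hilbertTrace {E : Type*} [NormedAddCommGroup E] [InnerProductSpace ℂ E]
    [CompleteSpace E] {ι : Type*} (b : HilbertBasis ι ℂ E) (T : E →L[ℂ] E) (K : Submodule ℂ E)
    [FiniteDimensional ℂ K] (hT : T ∘L K.starProjection = T) :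
    HasSum (fun i => inner ℂ (b i) (T (b i))) (hilbertTrace T) := by
  rw [hilbertTrace, (hasSum_inner_of_finite _ T K hT).tsum_eq]
  exact hasSum_inner_of_finite b T K hT

/-! ### Faces and the face amplitude -/

/-- A graph presented by its half-edges: `root h` is the vertex from which the half-edge `h` starts,
and `opp h` is the other half of the same edge. A half-edge is the same as a pair `(v, e)` of an
edge `e` and an end `v` of it. -/
structure HalfEdgeGraph (V H : Type*) where
  root : H → V
  opp : H → H
  opp_opp : ∀ h, opp (opp h) = h
  opp_ne : ∀ h, opp h ≠ h

/-- An internal face of a 2-complex with the given graph as 1-skeleton, by its oriented boundary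
cycle: the boundary passes the vertices `0, …, n` and returns from the last one to the first one,
leaving the `i`-th one along the half-edge `out i`. -/
structure InternalFace {V H : Type*} (𝒢 : HalfEdgeGraph V H) where
  n : ℕ
  out : Fin (n + 1) → H
  closed : ∀ i, 𝒢.root (𝒢.opp (out i)) = 𝒢.root (out (i + 1))

namespace InternalFace

variable {V H : Type*} {𝒢 : HalfEdgeGraph V H}

/-- The half-edge at the `i`-th vertex that belongs to the edge by which the boundary arrives. -/
def inc (h : InternalFace 𝒢) (i : Fin (h.n + 1)) : H := 𝒢.opp (h.out (i - 1))

/-- The wedge holonomy `g_{ve}⁻¹ g_{ve'}` at the `i`-th vertex `v`, with incoming edge `e` and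
outgoing edge `e'`. -/
def wedge (h : InternalFace 𝒢) (g : H → SL2C) (i : Fin (h.n + 1)) : SL2C :=
  (g (h.inc i))⁻¹ * g (h.out i)

/-- The holonomy around the face, the product of the wedge holonomies from left to right in the
order of the boundary cycle. -/
def holonomy (h : InternalFace 𝒢) (g : H → SL2C) : SL2C :=
  (List.ofFn (h.wedge g)).prod

/-- The face amplitude `τ_k^{(h)} = (k + 1) Tr_{(k,ρ)} [∏_v P_k D(g_{ve}⁻¹ g_{ve'}) P_k]`, with the
product from left to right in the order of the boundary cycle. -/
noncomputable def amplitude (h : InternalFace 𝒢) (k : ℕ) (ρ : ℝ) (g : H → SL2C) : ℂ :=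
  (k + 1) * hilbertTrace (List.ofFn fun i =>
    simplicityProj k ρ ∘L (principalSeries k ρ (h.wedge g i) : L2C →L[ℂ] L2C) ∘L
      simplicityProj k ρ).prod

end InternalFace

end Spinfoam

/-! Let `K` be the lowest subspace, of dimension `k + 1`. The operator under the trace is a product
`T` of compressions `P U P` of unitaries to `K`. It is a contraction that vanishes on the orthogonal
complement of `K`, so its trace is a sum of `k + 1` diagonal entries of modulus at most 1; the
prefactor of the amplitude supplies the second factor `k + 1`.

If the bound is attained, all diagonal entries equal one common phase and `T` is that phase on `K`
(`eq_smul_of_norm_hilbertTrace_eq`). Then no compression loses norm on `K`, so each unitary maps `K`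
into itself (`map_mem_of_norm_prod_compression`), and `T` agrees on `K` with the operator of the
holonomy.

Two facts about the representation remain. The stabiliser of `K` is `SU(2)`
(`principalSeries_mem_lowestSubspace`, `mem_specialUnitaryGroup_of_forall_mem`); the hard inclusion
uses Liouville's theorem. For `k ≥ 1`, only `±1` in `SU(2)` acts on `K` by a scalar
(`eq_one_or_eq_neg_one_of_forall_eq_smul`). -/

namespace Spinfoam

/-! ### Compressions of unitaries, and the trace of a contraction. -/

section Compression

variable {E : Type*} [NormedAddCommGroup E] [InnerProductSpace ℂ E]

/-- The compression `P U P` of a unitary operator to a subspace with orthogonal projection `P`. -/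
noncomputable def compression (K : Submodule ℂ E) [K.HasOrthogonalProjection] (U : E ≃ₗᵢ[ℂ] E) :
    E →L[ℂ] E :=
  K.starProjection ∘L (U : E →L[ℂ] E) ∘L K.starProjection

theorem compression_apply_of_mem {K : Submodule ℂ E} [K.HasOrthogonalProjection]
    (U : E ≃ₗᵢ[ℂ] E) {x : E} (hx : x ∈ K) : compression K U x = K.starProjection (U x) := by
  simp [compression, Submodule.starProjection_eq_self_iff.mpr hx]

theorem norm_compression_apply_le (K : Submodule ℂ E) [K.HasOrthogonalProjection]
    (U : E ≃ₗᵢ[ℂ] E) (x : E) : ‖compression K U x‖ ≤ ‖x‖ := by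
  calc ‖compression K U x‖ ≤ ‖U (K.starProjection x)‖ := K.norm_starProjection_apply_le _
    _ = ‖K.starProjection x‖ := U.norm_map _
    _ ≤ ‖x‖ := K.norm_starProjection_apply_le _

theorem norm_prod_compression_apply_le (K : Submodule ℂ E) [K.HasOrthogonalProjection]
    (l : List (E ≃ₗᵢ[ℂ] E)) (x : E) : ‖(l.map (compression K)).prod x‖ ≤ ‖x‖ := by
  induction l with
  | nil => simp
  | cons U l ih =>
    rw [List.map_cons, List.prod_cons]
    exact (norm_compression_apply_le K U _).trans ih

/-- The rightmost factor begins by projecting to `K`. The empty product is the identity, which is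
why it is excluded. This property reduces `hilbertTrace` to a finite sum over a basis of `K`. -/
theorem prod_compression_comp_starProjection (K : Submodule ℂ E) [K.HasOrthogonalProjection]
    (l : List (E ≃ₗᵢ[ℂ] E)) (hl : l ≠ []) :
    (l.map (compression K)).prod ∘L K.starProjection = (l.map (compression K)).prod := by
  induction l with
  | nil => exact absurd rfl hl
  | cons U l ih =>
    rw [List.map_cons, List.prod_cons]
    by_cases h : l = []
    · subst h
      ext x
      simp [compression, Submodule.starProjection_eq_self_iff.mpr]
    · ext x
      exact congrArg (compression K U) (DFunLike.congr_fun (ih h) x)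

/-- If all the operators preserve `K`, the product of the compressions is the compression of the
product. -/
theorem prod_compression_apply {K : Submodule ℂ E} [K.HasOrthogonalProjection]
    (l : List (E ≃ₗᵢ[ℂ] E)) (hl : ∀ U ∈ l, ∀ x ∈ K, U x ∈ K) {x : E} (hx : x ∈ K) :
    (l.map (compression K)).prod x = l.prod x ∧ l.prod x ∈ K := by
  induction l with
  | nil => exact ⟨rfl, hx⟩
  | cons U l ih =>
    obtain ⟨h1, h2⟩ := ih fun V hV => hl V (List.mem_cons_of_mem _ hV)
    have hU := hl U List.mem_cons_self _ h2
    rw [List.map_cons, List.prod_cons, List.prod_cons]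
    refine ⟨?_, hU⟩
    change compression K U ((l.map (compression K)).prod x) = U (l.prod x)
    rw [h1, compression_apply_of_mem U h2, Submodule.starProjection_eq_self_iff.mpr hU]

/-- If a product of compressions is isometric on `K`, every factor preserves `K`. -/
theorem map_mem_of_norm_prod_compression {K : Submodule ℂ E} [FiniteDimensional ℂ K]
    (l : List (E ≃ₗᵢ[ℂ] E)) (h : ∀ x ∈ K, ‖(l.map (compression K)).prod x‖ = ‖x‖) :
    ∀ U ∈ l, ∀ x ∈ K, U x ∈ K := by
  induction l with
  | nil => simp
  | cons U l ih =>
    have hstep : ∀ x ∈ K, ‖compression K U ((l.map (compression K)).prod x)‖ = ‖x‖ := by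
      intro x hx
      simpa using h x hx
    -- Both the head and the tail are contractions, so an isometric composite forces the tail to be
    -- isometric on `K`.
    have hl := ih fun x hx => le_antisymm (norm_prod_compression_apply_le K l x)
      ((hstep x hx).symm.le.trans (norm_compression_apply_le K U _))
    have hU : ∀ y ∈ K, U y ∈ K := by
      intro y hy
      -- On `K` the tail is the restriction of the unitary `l.prod`. An injective endomorphism of a
      -- finite-dimensional space is onto, so every `y ∈ K` is an output of the tail.
      let S : K →ₗ[ℂ] K := (l.prod.toLinearEquiv : E →ₗ[ℂ] E).restrict
        fun x hx => (prod_compression_apply l hl hx).2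
      have hS : Function.Injective S := fun a b hab =>
        Subtype.ext (l.prod.injective (congrArg Subtype.val hab))
      obtain ⟨x, hx⟩ := LinearMap.injective_iff_surjective.mp hS ⟨y, hy⟩
      have hxy : l.prod x = y := congrArg Subtype.val hx
      have h1 := hstep x x.2
      rw [(prod_compression_apply l hl x.2).1, hxy, compression_apply_of_mem U hy,
        ← l.prod.norm_map (x : E), hxy, ← U.norm_map y] at h1
      -- Projecting `U y` to `K` preserves its norm only if `U y` already lies in `K`.
      exact (K.mem_iff_norm_starProjection _).mpr h1
    intro V hV
    rcases List.mem_cons.mp hV with rfl | hV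
    · exact hU
    · exact hl V hV

theorem norm_coe_stdOrthonormalBasis (K : Submodule ℂ E) [FiniteDimensional ℂ K]
    (j : Fin (Module.finrank ℂ K)) : ‖(stdOrthonormalBasis ℂ K j : E)‖ = 1 :=
  (stdOrthonormalBasis ℂ K).orthonormal.1 j

theorem norm_inner_stdOrthonormalBasis_le {T : E →L[ℂ] E} (K : Submodule ℂ E)
    [FiniteDimensional ℂ K] (hn : ∀ x, ‖T x‖ ≤ ‖x‖) (j : Fin (Module.finrank ℂ K)) :
    ‖inner ℂ (stdOrthonormalBasis ℂ K j : E) (T (stdOrthonormalBasis ℂ K j))‖ ≤ 1 := by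
  refine (norm_inner_le_norm _ _).trans ?_
  have := hn (stdOrthonormalBasis ℂ K j)
  rw [norm_coe_stdOrthonormalBasis] at *
  linarith

variable [CompleteSpace E]

theorem hilbertTrace_eq_sum (T : E →L[ℂ] E) (K : Submodule ℂ E) [FiniteDimensional ℂ K]
    (hT : T ∘L K.starProjection = T) :
    hilbertTrace T
      = ∑ j, inner ℂ (stdOrthonormalBasis ℂ K j : E) (T (stdOrthonormalBasis ℂ K j)) := by
  rw [hilbertTrace, (hasSum_inner_of_finite _ T K hT).tsum_eq]

theorem norm_hilbertTrace_le {T : E →L[ℂ] E} (K : Submodule ℂ E) [FiniteDimensional ℂ K]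
    (hT : T ∘L K.starProjection = T) (hn : ∀ x, ‖T x‖ ≤ ‖x‖) :
    ‖hilbertTrace T‖ ≤ Module.finrank ℂ K := by
  rw [hilbertTrace_eq_sum T K hT]
  refine (norm_sum_le_of_le _ fun j _ => norm_inner_stdOrthonormalBasis_le K hn j).trans ?_
  simp

theorem hilbertTrace_of_eq_smul {T : E →L[ℂ] E} (K : Submodule ℂ E) [FiniteDimensional ℂ K]
    (hT : T ∘L K.starProjection = T) {c : ℂ} (hc : ∀ x ∈ K, T x = c • x) :
    hilbertTrace T = Module.finrank ℂ K * c := by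
  rw [hilbertTrace_eq_sum T K hT]
  have h : ∀ j, inner ℂ (stdOrthonormalBasis ℂ K j : E) (T (stdOrthonormalBasis ℂ K j)) = c := by
    intro j
    rw [hc _ (stdOrthonormalBasis ℂ K j).2, inner_smul_right, inner_self_eq_norm_sq_to_K,
      norm_coe_stdOrthonormalBasis]
    simp
  simp [h]

/-- A contraction whose trace over `K` has the largest possible modulus is a phase on `K`. -/
theorem eq_smul_of_norm_hilbertTrace_eq {T : E →L[ℂ] E} (K : Submodule ℂ E)
    [FiniteDimensional ℂ K] (hT : T ∘L K.starProjection = T) (hn : ∀ x, ‖T x‖ ≤ ‖x‖)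
    (hK : 0 < Module.finrank ℂ K) (h : ‖hilbertTrace T‖ = Module.finrank ℂ K) :
    ∃ c : ℂ, ‖c‖ = 1 ∧ ∀ x ∈ K, T x = c • x := by
  set n := Module.finrank ℂ K
  have hn0 : (0 : ℝ) < n := by exact_mod_cast hK
  let e := stdOrthonormalBasis ℂ K
  -- The mean of the diagonal entries; by hypothesis it has modulus 1.
  let c : ℂ := hilbertTrace T / n
  have hc : ‖c‖ = 1 := by
    simp only [c, norm_div, h, Complex.norm_natCast]
    exact div_self hn0.ne'
  have hle : ∀ j ∈ Finset.univ,
      ((starRingEnd ℂ) c * inner ℂ (e j : E) (T (e j))).re ≤ (fun _ => (1 : ℝ)) j := by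
    intro j _
    refine (Complex.re_le_norm _).trans ?_
    rw [norm_mul, RCLike.norm_conj, hc, one_mul]
    exact norm_inner_stdOrthonormalBasis_le K hn j
  have hsum : ∑ j, ((starRingEnd ℂ) c * inner ℂ (e j : E) (T (e j))).re
      = ∑ _j : Fin n, (1 : ℝ) := by
    rw [← Complex.re_sum, ← Finset.mul_sum, ← hilbertTrace_eq_sum T K hT]
    have : hilbertTrace T = n * c := by
      have : (n : ℂ) ≠ 0 := by exact_mod_cast hK.ne'
      simp only [c]
      field_simp
    rw [this, mul_left_comm, ← Complex.normSq_eq_conj_mul_self, Complex.normSq_eq_norm_sq, hc]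
    simp
  -- The `n` real parts are at most 1 and sum to `n`, so each equals 1.
  have heq := (Finset.sum_eq_sum_iff_of_le hle).mp hsum
  have hej : ∀ j, T (e j) = c • (e j : E) := by
    intro j
    have h1 : ‖(e j : E)‖ = 1 := norm_coe_stdOrthonormalBasis K j
    have h2 := hn (e j)
    -- Equality in Cauchy–Schwarz: the expansion is `‖T (e j)‖ ^ 2 - 2 + 1`.
    have h3 : ‖T (e j) - c • (e j : E)‖ ^ 2 ≤ 0 := by
      rw [@norm_sub_sq ℂ, inner_smul_right, norm_smul, hc, h1, ← inner_conj_symm]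
      have h4 := heq j (Finset.mem_univ j)
      have h5 : RCLike.re (c * (starRingEnd ℂ) (inner ℂ (e j : E) (T (e j)))) = 1 := by
        rw [← h4, ← Complex.conj_re]
        simp
      rw [h5]
      nlinarith [norm_nonneg (T (e j))]
    exact sub_eq_zero.mp (norm_eq_zero.mp (pow_eq_zero_iff two_ne_zero |>.mp
      (le_antisymm h3 (by positivity))))
  refine ⟨c, hc, fun x hx => ?_⟩
  have hx' : x = ∑ j, inner ℂ (e j) (⟨x, hx⟩ : K) • (e j : E) := by
    have := congrArg Subtype.val (e.sum_repr' ⟨x, hx⟩)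
    simpa using this.symm
  rw [hx', map_sum, Finset.smul_sum]
  refine Finset.sum_congr rfl fun j _ => ?_
  rw [map_smul, hej, smul_comm]

end Compression

/-! ### The lowest subspace in terms of polynomials -/

/-- The exponent of `1 + |z|²` in the functions spanning the lowest subspace. -/
noncomputable def lowestExponent (k : ℕ) (ρ : ℝ) : ℂ := Complex.I * ρ / 2 - 1 - k / 2

theorem lowestExponent_re (k : ℕ) (ρ : ℝ) : (lowestExponent k ρ).re = -(1 + (k : ℝ) / 2) := by
  simp [lowestExponent]
  ring

/-- The squared norm of the row vector `(z, 1) g`. -/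
noncomputable def rowNormSq (g : SL2C) (z : ℂ) : ℝ :=
  ‖g.1 0 0 * z + g.1 1 0‖ ^ 2 + ‖denom g z‖ ^ 2

/-- The weight `(1 + |z|²) ^ (iρ/2 - 1 - k/2)`. -/
noncomputable def weight (k : ℕ) (ρ : ℝ) (z : ℂ) : ℂ :=
  ((1 + ‖z‖ ^ 2 : ℝ) : ℂ) ^ lowestExponent k ρ

theorem weight_ne_zero (k : ℕ) (ρ : ℝ) (z : ℂ) : weight k ρ z ≠ 0 := by
  have h : (0 : ℝ) < 1 + ‖z‖ ^ 2 := by positivity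
  exact (Complex.cpow_ne_zero_iff_of_exponent_ne_zero (by
    intro h0
    have h1 := lowestExponent_re k ρ
    rw [h0, Complex.zero_re] at h1
    have : (0 : ℝ) ≤ k := Nat.cast_nonneg k
    linarith)).mpr (by exact_mod_cast h.ne')

/-- Elements of `L2C` are equal only almost everywhere. Continuity of both sides turns such
equalities into pointwise ones. -/
theorem continuous_ofReal_cpow {F : ℂ → ℝ} (hF : Continuous F) (hpos : ∀ z, 0 < F z)
    (s : ℂ) : Continuous fun z => (F z : ℂ) ^ s :=
  (Complex.continuous_ofReal.comp hF).cpow continuous_const fun z =>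
    Or.inl (by simpa using hpos z)

theorem continuous_weight (k : ℕ) (ρ : ℝ) : Continuous (weight k ρ) :=
  continuous_ofReal_cpow (by fun_prop) (fun z => by positivity) _

theorem lowestFun_eq (k : ℕ) (ρ : ℝ) (m : ℕ) (z : ℂ) :
    lowestFun k ρ m z = (starRingEnd ℂ) z ^ m * weight k ρ z := rfl

/-- The elements of the lowest subspace are the polynomials of degree at most `k` in `conj z`
times the weight. -/
theorem mem_lowestSubspace_iff (k : ℕ) (ρ : ℝ) (f : L2C) :
    f ∈ lowestSubspace k ρ ↔ ∃ p : Polynomial ℂ, p.natDegree ≤ k ∧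
      f =ᵐ[volume] fun z => p.eval ((starRingEnd ℂ) z) * weight k ρ z := by
  constructor
  · intro hf
    induction hf using Submodule.span_induction with
    | mem x hx =>
      obtain ⟨m, rfl⟩ := hx
      refine ⟨Polynomial.X ^ (m : ℕ), by simpa using Nat.lt_succ_iff.mp m.2, ?_⟩
      filter_upwards [(memLp_lowestFun k ρ (Nat.lt_succ_iff.mp m.2)).coeFn_toLp] with z hz
      rw [hz, lowestFun_eq]
      simp
    | zero =>
      refine ⟨0, by simp, ?_⟩
      filter_upwards [Lp.coeFn_zero ℂ 2 (volume : Measure ℂ)] with z hz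
      rw [hz]
      simp
    | add x y _ _ hx hy =>
      obtain ⟨p, hp, hpx⟩ := hx
      obtain ⟨q, hq, hqy⟩ := hy
      refine ⟨p + q, (Polynomial.natDegree_add_le p q).trans (max_le hp hq), ?_⟩
      filter_upwards [Lp.coeFn_add x y, hpx, hqy] with z hz hzx hzy
      rw [hz, Pi.add_apply, hzx, hzy, Polynomial.eval_add, add_mul]
    | smul c x _ hx =>
      obtain ⟨p, hp, hpx⟩ := hx
      refine ⟨c • p, (Polynomial.natDegree_smul_le c p).trans hp, ?_⟩
      filter_upwards [Lp.coeFn_smul c x, hpx] with z hz hzx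
      rw [hz, Pi.smul_apply, hzx, Polynomial.eval_smul, smul_eq_mul, smul_eq_mul, mul_assoc]
  · rintro ⟨p, hp, hf⟩
    let F : Fin (k + 1) → L2C := fun m => (memLp_lowestFun k ρ (Nat.lt_succ_iff.mp m.2)).toLp
    have hsum : f = ∑ m : Fin (k + 1), p.coeff m • F m := by
      apply Lp.ext
      have h : ∀ᵐ z ∂(volume : Measure ℂ), ∀ m : Fin (k + 1),
          (p.coeff m • F m : L2C) z = p.coeff m * lowestFun k ρ m z := by
        rw [ae_all_iff]
        intro m
        filter_upwards [Lp.coeFn_smul (p.coeff m) (F m),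
          (memLp_lowestFun k ρ (Nat.lt_succ_iff.mp m.2)).coeFn_toLp] with z hz hz'
        rw [hz, Pi.smul_apply, smul_eq_mul]
        exact congrArg _ hz'
      filter_upwards [hf, h, Lp.coeFn_finsetSum Finset.univ fun m : Fin (k + 1) => p.coeff m • F m]
        with z hz hm hs
      rw [hz, hs]
      simp only [Finset.sum_apply, hm, lowestFun_eq]
      rw [Polynomial.eval_eq_sum_range' (Nat.lt_succ_iff.mpr hp), Finset.sum_mul,
        Finset.sum_range]
      exact Finset.sum_congr rfl fun m _ => by ring
    rw [hsum]
    exact Submodule.sum_mem _ fun m _ => Submodule.smul_mem _ _ (Submodule.subset_span ⟨m, rfl⟩)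

theorem memLp_eval_mul_weight (k : ℕ) (ρ : ℝ) {p : Polynomial ℂ} (hp : p.natDegree ≤ k) :
    MemLp (fun z => p.eval ((starRingEnd ℂ) z) * weight k ρ z) 2 (volume : Measure ℂ) := by
  have h : (fun z => p.eval ((starRingEnd ℂ) z) * weight k ρ z)
      = ∑ m ∈ Finset.range (k + 1), p.coeff m • lowestFun k ρ m := by
    funext z
    rw [Polynomial.eval_eq_sum_range' (Nat.lt_succ_iff.mpr hp), Finset.sum_mul, Finset.sum_apply]
    refine Finset.sum_congr rfl fun m _ => ?_
    rw [Pi.smul_apply, lowestFun_eq, smul_eq_mul, mul_assoc]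
  rw [h]
  exact memLp_finsetSum' _ fun m hm =>
    (memLp_lowestFun k ρ (Nat.lt_succ_iff.mp (Finset.mem_range.mp hm))).const_smul _

/-- The element of the lowest subspace with a given polynomial. -/
noncomputable def lowestVec (k : ℕ) (ρ : ℝ) (p : Polynomial ℂ) (hp : p.natDegree ≤ k) : L2C :=
  (memLp_eval_mul_weight k ρ hp).toLp

theorem coeFn_lowestVec (k : ℕ) (ρ : ℝ) {p : Polynomial ℂ} (hp : p.natDegree ≤ k) :
    lowestVec k ρ p hp =ᵐ[volume] fun z => p.eval ((starRingEnd ℂ) z) * weight k ρ z :=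
  (memLp_eval_mul_weight k ρ hp).coeFn_toLp

theorem lowestVec_mem (k : ℕ) (ρ : ℝ) {p : Polynomial ℂ} (hp : p.natDegree ≤ k) :
    lowestVec k ρ p hp ∈ lowestSubspace k ρ :=
  (mem_lowestSubspace_iff k ρ _).mpr ⟨p, hp, coeFn_lowestVec k ρ hp⟩

/-- In a vanishing linear combination the nowhere zero weight cancels, and by continuity the
remaining polynomial in `conj z` vanishes everywhere, so its coefficients are zero. -/
theorem finrank_lowestSubspace (k : ℕ) (ρ : ℝ) :
    Module.finrank ℂ (lowestSubspace k ρ) = k + 1 := by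
  rw [lowestSubspace, finrank_span_eq_card, Fintype.card_fin]
  rw [Fintype.linearIndependent_iff]
  intro c hc i
  let p : Polynomial ℂ := ∑ m : Fin (k + 1), Polynomial.monomial (m : ℕ) (c m)
  have hcoeff : p.coeff i = c i := by
    simp [p, Polynomial.finsetSum_coeff, Polynomial.coeff_monomial, Fin.val_inj]
  have h : ∀ᵐ z ∂(volume : Measure ℂ), ∀ m : Fin (k + 1),
      (c m • (memLp_lowestFun k ρ (Nat.lt_succ_iff.mp m.2)).toLp : L2C) z
        = c m * lowestFun k ρ m z := by
    rw [ae_all_iff]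
    intro m
    filter_upwards [Lp.coeFn_smul (c m) ((memLp_lowestFun k ρ (Nat.lt_succ_iff.mp m.2)).toLp),
      (memLp_lowestFun k ρ (Nat.lt_succ_iff.mp m.2)).coeFn_toLp] with z hz hz'
    rw [hz, Pi.smul_apply, smul_eq_mul, hz']
  have hae : (fun z => p.eval ((starRingEnd ℂ) z)) =ᵐ[volume] fun _ => (0 : ℂ) := by
    filter_upwards [h, Lp.coeFn_finsetSum Finset.univ fun m : Fin (k + 1) =>
      (c m • (memLp_lowestFun k ρ (Nat.lt_succ_iff.mp m.2)).toLp : L2C),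
      Lp.coeFn_zero ℂ 2 (volume : Measure ℂ)] with z hm hs h0
    rw [hc, h0] at hs
    simp only [Finset.sum_apply, hm, lowestFun_eq, ← mul_assoc, ← Finset.sum_mul] at hs
    have h1 := (mul_eq_zero.mp hs.symm).resolve_right (weight_ne_zero k ρ z)
    simpa [p, Polynomial.eval_finsetSum] using h1
  have hcont : Continuous fun z => p.eval ((starRingEnd ℂ) z) :=
    p.continuous.comp Complex.continuous_conj
  have heq := (hcont.ae_eq_iff_eq volume continuous_const).mp hae
  have hp : p = 0 := Polynomial.funext fun z => by
    simpa using congrFun heq ((starRingEnd ℂ) z)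
  rw [← hcoeff, hp, Polynomial.coeff_zero]

/-! ### The action on the lowest subspace -/

/-- With `w = denom g z`, `rowNormSq g z = |w| ^ 2 * (1 + |moebius g z| ^ 2)`, and twice the lowest
exponent is `iρ - 2 - k`. The powers of `|w|` from the character and from the weight therefore
combine, leaving only `conj w ^ k`. -/
theorem character_mul_weight_moebius (k : ℕ) (ρ : ℝ) (g : SL2C) {z : ℂ} (hz : denom g z ≠ 0) :
    character k ρ (denom g z) * weight k ρ (moebius g z)
      = (starRingEnd ℂ) (denom g z) ^ k * (rowNormSq g z : ℂ) ^ lowestExponent k ρ := by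
  have hw : 0 < ‖denom g z‖ := norm_pos_iff.mpr hz
  have hwC : (‖denom g z‖ : ℂ) ≠ 0 := by exact_mod_cast hw.ne'
  have hQ : rowNormSq g z = ‖denom g z‖ ^ 2 * (1 + ‖moebius g z‖ ^ 2) := by
    rw [rowNormSq, moebius, norm_div]
    field_simp
    ring
  have h2 : ((‖denom g z‖ ^ 2 : ℝ) : ℂ) ^ lowestExponent k ρ
      = (‖denom g z‖ : ℂ) ^ (Complex.I * ρ - 2) * ((‖denom g z‖ : ℂ) ^ k)⁻¹ := by
    have h3 : ((‖denom g z‖ ^ 2 : ℝ) : ℂ) = (‖denom g z‖ : ℂ) * ‖denom g z‖ := by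
      push_cast; ring
    rw [h3, Complex.mul_cpow_ofReal_nonneg hw.le hw.le, ← Complex.cpow_add _ _ hwC,
      ← Complex.cpow_natCast, ← Complex.cpow_neg, ← Complex.cpow_add _ _ hwC]
    congr 1
    rw [lowestExponent]
    ring
  rw [hQ, Complex.ofReal_mul, Complex.mul_cpow_ofReal_nonneg (by positivity) (by positivity), h2,
    weight, character, div_pow]
  ring

theorem coeFn_principalSeries (k : ℕ) (ρ : ℝ) (g : SL2C) (f : L2C) :
    principalSeries k ρ g f =ᵐ[volume] actFun k ρ g f :=
  coeFn_actIsometry k ρ g f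

theorem principalSeries_lowestVec (k : ℕ) (ρ : ℝ) (g : SL2C) {p : Polynomial ℂ}
    (hp : p.natDegree ≤ k) :
    principalSeries k ρ g (lowestVec k ρ p hp) =ᵐ[volume] fun z =>
      ((starRingEnd ℂ) (denom g z) ^ k * p.eval ((starRingEnd ℂ) (moebius g z)))
        * (rowNormSq g z : ℂ) ^ lowestExponent k ρ := by
  filter_upwards [coeFn_principalSeries k ρ g (lowestVec k ρ p hp),
    actFun_congr k ρ g (coeFn_lowestVec k ρ hp), ae_regular g] with z h1 h2 hz
  rw [h1, h2, actFun, mul_left_comm, character_mul_weight_moebius k ρ g hz]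
  ring

/-- The factor of degree `k` clears the denominators: `p` becomes its homogenisation to degree `k`,
evaluated at the conjugated components of `(z, 1) g`. -/
theorem denom_pow_mul_eval_moebius (g : SL2C) {k : ℕ} {p : Polynomial ℂ} (hp : p.natDegree ≤ k)
    {z : ℂ} (hz : denom g z ≠ 0) :
    (starRingEnd ℂ) (denom g z) ^ k * p.eval ((starRingEnd ℂ) (moebius g z))
      = ∑ m ∈ Finset.range (k + 1), p.coeff m *
        ((starRingEnd ℂ) (g.1 0 0 * z + g.1 1 0) ^ m
          * (starRingEnd ℂ) (denom g z) ^ (k - m)) := by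
  rw [Polynomial.eval_eq_sum_range' (Nat.lt_succ_iff.mpr hp), Finset.mul_sum]
  refine Finset.sum_congr rfl fun m hm => ?_
  have hm' : m ≤ k := Nat.lt_succ_iff.mp (Finset.mem_range.mp hm)
  have hz' : (starRingEnd ℂ) (denom g z) ≠ 0 := by simpa using hz
  rw [moebius, map_div₀, div_pow, ← pow_sub_mul_pow _ hm']
  field_simp

theorem ofReal_rowNormSq (g : SL2C) (z : ℂ) :
    (rowNormSq g z : ℂ) = (g.1 0 0 * z + g.1 1 0) * (starRingEnd ℂ) (g.1 0 0 * z + g.1 1 0)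
      + denom g z * (starRingEnd ℂ) (denom g z) := by
  rw [rowNormSq, Complex.mul_conj', Complex.mul_conj']
  push_cast
  rfl

theorem rowNormSq_of_mem_specialUnitaryGroup {g : SL2C}
    (hg : (g : Matrix (Fin 2) (Fin 2) ℂ) ∈ Matrix.specialUnitaryGroup (Fin 2) ℂ) (z : ℂ) :
    rowNormSq g z = 1 + ‖z‖ ^ 2 := by
  have hu := Matrix.mem_unitaryGroup_iff.mp (Matrix.mem_specialUnitaryGroup_iff.mp hg).1
  have h (i j : Fin 2) := congrFun (congrFun hu i) j
  simp only [Matrix.mul_apply, Fin.sum_univ_two, Matrix.star_apply] at h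
  have h00 := h 0 0
  have h01 := h 0 1
  have h10 := h 1 0
  have h11 := h 1 1
  simp at h00 h01 h10 h11
  apply Complex.ofReal_injective
  rw [ofReal_rowNormSq]
  push_cast
  rw [← Complex.mul_conj', denom]
  simp only [map_add, map_mul]
  linear_combination z * (starRingEnd ℂ) z * h00 + z * h01 + (starRingEnd ℂ) z * h10 + h11

/-- `rowNormSq g z` is the Hermitian form of `g g*` at `(z, 1)`. Polarisation gives `g g* = c`,
determinants give `c ^ 2 = 1`, and positivity leaves `c = 1`. -/
theorem mem_specialUnitaryGroup_of_rowNormSq {g : SL2C} {c : ℝ}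
    (h : ∀ z, rowNormSq g z = c * (1 + ‖z‖ ^ 2)) :
    (g : Matrix (Fin 2) (Fin 2) ℂ) ∈ Matrix.specialUnitaryGroup (Fin 2) ℂ := by
  have hC : ∀ z : ℂ, (g.1 0 0 * z + g.1 1 0) * (starRingEnd ℂ) (g.1 0 0 * z + g.1 1 0)
      + denom g z * (starRingEnd ℂ) (denom g z) = c * (1 + z * (starRingEnd ℂ) z) := by
    intro z
    rw [← ofReal_rowNormSq, h, Complex.mul_conj']
    push_cast
    rfl
  have hdet := det_eq g
  have hdet' := congrArg (starRingEnd ℂ) hdet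
  -- The points `0, 1, -1, I` determine the four entries of `g g*`.
  have h0 := hC 0
  have h1 := hC 1
  have h2 := hC (-1)
  have h3 := hC Complex.I
  simp only [denom, map_add, map_mul, map_sub, map_neg, map_one, map_zero, Complex.conj_I]
    at h0 h1 h2 h3 hdet'
  set a := g.1 0 0
  set b := g.1 0 1
  set c' := g.1 1 0
  set d := g.1 1 1
  have hI := Complex.I_sq
  have e11 : c' * (starRingEnd ℂ) c' + d * (starRingEnd ℂ) d = c := by linear_combination h0
  have e00 : a * (starRingEnd ℂ) a + b * (starRingEnd ℂ) b = c := by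
    linear_combination (h1 + h2) / 2 - h0
  have hs : (a * (starRingEnd ℂ) c' + b * (starRingEnd ℂ) d)
      + (c' * (starRingEnd ℂ) a + d * (starRingEnd ℂ) b) = 0 := by
    linear_combination (h1 - h2) / 2
  have hm : Complex.I * ((a * (starRingEnd ℂ) c' + b * (starRingEnd ℂ) d)
      - (c' * (starRingEnd ℂ) a + d * (starRingEnd ℂ) b)) = 0 := by
    linear_combination h3 - e11 - e00 +
      (a * (starRingEnd ℂ) a + b * (starRingEnd ℂ) b - c) * hI
  have hm' := (mul_eq_zero.mp hm).resolve_left Complex.I_ne_zero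
  have e01 : a * (starRingEnd ℂ) c' + b * (starRingEnd ℂ) d = 0 := by
    linear_combination (hs + hm') / 2
  have e10 : c' * (starRingEnd ℂ) a + d * (starRingEnd ℂ) b = 0 := by
    linear_combination (hs - hm') / 2
  -- The determinant of `g g*` is the product of `det g` and its conjugate.
  have hsq : (c : ℂ) ^ 2 = 1 := by
    rw [sq]
    calc (c : ℂ) * c = (a * (starRingEnd ℂ) a + b * (starRingEnd ℂ) b)
          * (c' * (starRingEnd ℂ) c' + d * (starRingEnd ℂ) d)
          - (a * (starRingEnd ℂ) c' + b * (starRingEnd ℂ) d)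
          * (c' * (starRingEnd ℂ) a + d * (starRingEnd ℂ) b) := by rw [e00, e11, e01]; ring
      _ = (a * d - b * c') * ((starRingEnd ℂ) a * (starRingEnd ℂ) d
          - (starRingEnd ℂ) b * (starRingEnd ℂ) c') := by ring
      _ = 1 := by rw [hdet, hdet', one_mul]
  have hc0 : 0 ≤ c := by
    have := h 0
    simp only [norm_zero] at this
    have h4 : 0 ≤ rowNormSq g 0 := by unfold rowNormSq; positivity
    linarith
  have hc1 : c = 1 := by
    have h5 : c ^ 2 = 1 := by exact_mod_cast hsq
    nlinarith
  rw [hc1, Complex.ofReal_one] at e00 e11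
  rw [Matrix.mem_specialUnitaryGroup_iff, Matrix.mem_unitaryGroup_iff]
  refine ⟨?_, g.2⟩
  ext i j
  fin_cases i <;> fin_cases j <;>
    simp [Matrix.mul_apply, Fin.sum_univ_two, Matrix.star_apply]
  exacts [e00, e01, e10, e11]

/-- Cauchy–Schwarz for `(z, 1) = ((z, 1) g) g⁻¹`: since `det g = 1`, the entries of `g⁻¹` are those
of `g` up to sign and position. This is the bound needed for Liouville's theorem. -/
theorem one_add_norm_sq_le (g : SL2C) (z : ℂ) :
    1 + ‖z‖ ^ 2 ≤ (‖g.1 0 0‖ ^ 2 + ‖g.1 0 1‖ ^ 2 + ‖g.1 1 0‖ ^ 2 + ‖g.1 1 1‖ ^ 2)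
      * rowNormSq g z := by
  have hdet := det_eq g
  have key : ∀ x y u v w : ℂ, w = x * u - y * v →
      ‖w‖ ^ 2 ≤ (‖x‖ ^ 2 + ‖y‖ ^ 2) * (‖v‖ ^ 2 + ‖u‖ ^ 2) := by
    rintro x y u v w rfl
    have h : ‖x * u - y * v‖ ≤ ‖x‖ * ‖u‖ + ‖y‖ * ‖v‖ := by
      simpa using norm_sub_le (x * u) (y * v)
    calc ‖x * u - y * v‖ ^ 2 ≤ (‖x‖ * ‖u‖ + ‖y‖ * ‖v‖) ^ 2 := by gcongr
      _ ≤ _ := by nlinarith [sq_nonneg (‖x‖ * ‖v‖ - ‖y‖ * ‖u‖)]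
  have h1 := key (g.1 0 0) (g.1 0 1) (denom g z) (g.1 0 0 * z + g.1 1 0) 1 (by
    rw [denom]; linear_combination -hdet)
  have h2 := key (-g.1 1 0) (-g.1 1 1) (denom g z) (g.1 0 0 * z + g.1 1 0) z (by
    rw [denom]; linear_combination -z * hdet)
  simp only [norm_one, norm_neg] at h1 h2
  rw [rowNormSq]
  linarith

theorem rowNormSq_pos (g : SL2C) (z : ℂ) : 0 < rowNormSq g z := by
  by_contra! h
  have h1 := one_add_norm_sq_le g z
  have h2 : 0 ≤ ‖g.1 0 0‖ ^ 2 + ‖g.1 0 1‖ ^ 2 + ‖g.1 1 0‖ ^ 2 + ‖g.1 1 1‖ ^ 2 := by positivity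
  nlinarith [sq_nonneg ‖z‖, mul_nonneg h2 (neg_nonneg.mpr h)]

theorem continuous_rowNormSq (g : SL2C) : Continuous (rowNormSq g) := by
  unfold rowNormSq denom
  fun_prop

theorem exists_eq_lowestVec {k : ℕ} {ρ : ℝ} {f : L2C} (hf : f ∈ lowestSubspace k ρ) :
    ∃ (p : Polynomial ℂ) (hp : p.natDegree ≤ k), f = lowestVec k ρ p hp := by
  obtain ⟨p, hp, h⟩ := (mem_lowestSubspace_iff k ρ f).mp hf
  exact ⟨p, hp, Lp.ext (h.trans (coeFn_lowestVec k ρ hp).symm)⟩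

/-- `SU(2)` preserves the lowest subspace. -/
theorem principalSeries_mem_lowestSubspace (k : ℕ) (ρ : ℝ) {g : SL2C}
    (hg : (g : Matrix (Fin 2) (Fin 2) ℂ) ∈ Matrix.specialUnitaryGroup (Fin 2) ℂ) {f : L2C}
    (hf : f ∈ lowestSubspace k ρ) : principalSeries k ρ g f ∈ lowestSubspace k ρ := by
  obtain ⟨p, hp, rfl⟩ := exists_eq_lowestVec hf
  rw [mem_lowestSubspace_iff]
  -- At `conj z`, `A` and `B` are the conjugated components of `(z, 1) g`; the witness is the
  -- homogenised `p` evaluated on them.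
  let A : Polynomial ℂ := Polynomial.C ((starRingEnd ℂ) (g.1 0 0)) * Polynomial.X
    + Polynomial.C ((starRingEnd ℂ) (g.1 1 0))
  let B : Polynomial ℂ := Polynomial.C ((starRingEnd ℂ) (g.1 0 1)) * Polynomial.X
    + Polynomial.C ((starRingEnd ℂ) (g.1 1 1))
  refine ⟨∑ m ∈ Finset.range (k + 1), Polynomial.C (p.coeff m) * (A ^ m * B ^ (k - m)), ?_, ?_⟩
  · refine Polynomial.natDegree_sum_le_of_forall_le _ _ fun m hm => ?_
    have hm' : m ≤ k := Nat.lt_succ_iff.mp (Finset.mem_range.mp hm)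
    have hA : (A ^ m).natDegree ≤ m * 1 := Polynomial.natDegree_pow_le_of_le m
      Polynomial.natDegree_linear_le
    have hB : (B ^ (k - m)).natDegree ≤ (k - m) * 1 := Polynomial.natDegree_pow_le_of_le _
      Polynomial.natDegree_linear_le
    refine (Polynomial.natDegree_C_mul_le _ _).trans (Polynomial.natDegree_mul_le.trans ?_)
    omega
  · filter_upwards [principalSeries_lowestVec k ρ g hp, ae_regular g] with z hz hreg
    rw [hz, denom_pow_mul_eval_moebius g hp hreg, rowNormSq_of_mem_specialUnitaryGroup hg,
      Polynomial.eval_finsetSum]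
    simp [A, B, denom, weight]

/-- Only `SU(2)` preserves the lowest subspace. -/
theorem mem_specialUnitaryGroup_of_forall_mem (k : ℕ) (ρ : ℝ) {g : SL2C}
    (hg : ∀ f ∈ lowestSubspace k ρ, principalSeries k ρ g f ∈ lowestSubspace k ρ) :
    (g : Matrix (Fin 2) (Fin 2) ℂ) ∈ Matrix.specialUnitaryGroup (Fin 2) ℂ := by
  -- Chosen so that its image under `g` has polynomial factor 1: the base is the conjugate of `g₀₀ -
  -- g₀₁ x`, which at `x = moebius g z` is the inverse of `denom g z`. The image is then a bare
  -- power of `rowNormSq g`, and its membership in the lowest subspace makes that power a polynomial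
  -- times the weight.
  let p : Polynomial ℂ := (Polynomial.C (-(starRingEnd ℂ) (g.1 0 1)) * Polynomial.X
    + Polynomial.C ((starRingEnd ℂ) (g.1 0 0))) ^ k
  have hp : p.natDegree ≤ k := by
    have h := Polynomial.natDegree_pow_le_of_le k
      (Polynomial.natDegree_linear_le (a := -(starRingEnd ℂ) (g.1 0 1))
        (b := (starRingEnd ℂ) (g.1 0 0)))
    rwa [mul_one] at h
  obtain ⟨q, -, hq⟩ := (mem_lowestSubspace_iff k ρ _).mp (hg _ (lowestVec_mem k ρ hp))
  have hae : (fun z => (rowNormSq g z : ℂ) ^ lowestExponent k ρ) =ᵐ[volume]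
      fun z => q.eval ((starRingEnd ℂ) z) * weight k ρ z := by
    filter_upwards [hq, principalSeries_lowestVec k ρ g hp, ae_regular g] with z h1 h2 hz
    rw [← h1, h2]
    have hone : (starRingEnd ℂ) (denom g z) ^ k * p.eval ((starRingEnd ℂ) (moebius g z)) = 1 := by
      have h3 : denom g z * (-g.1 0 1 * moebius g z + g.1 0 0) = 1 := by
        rw [moebius]
        field_simp
        rw [denom]
        linear_combination det_eq g
      have h4 := congrArg (starRingEnd ℂ) h3
      simp only [map_mul, map_add, map_neg, map_one] at h4
      simp only [p, Polynomial.eval_pow, Polynomial.eval_add, Polynomial.eval_mul,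
        Polynomial.eval_C, Polynomial.eval_X]
      rw [← mul_pow, h4, one_pow]
    rw [hone, one_mul]
  have heq : ∀ z, (rowNormSq g z : ℂ) ^ lowestExponent k ρ
      = q.eval ((starRingEnd ℂ) z) * weight k ρ z := congrFun
    (((continuous_ofReal_cpow (continuous_rowNormSq g) (rowNormSq_pos g) _).ae_eq_iff_eq volume
      ((q.continuous.comp Complex.continuous_conj).mul (continuous_weight k ρ))).mp hae)
  have hr : (0 : ℝ) < 1 + (k : ℝ) / 2 := by positivity
  have hu : ∀ z : ℂ, (0 : ℝ) < 1 + ‖z‖ ^ 2 := fun z => by positivity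
  have hnorm : ∀ z, ‖q.eval ((starRingEnd ℂ) z)‖
      = ((1 + ‖z‖ ^ 2) / rowNormSq g z) ^ (1 + (k : ℝ) / 2) := by
    intro z
    have h := congrArg norm (heq z)
    rw [norm_mul, weight, Complex.norm_cpow_eq_rpow_re_of_pos (rowNormSq_pos g z),
      Complex.norm_cpow_eq_rpow_re_of_pos (hu z), lowestExponent_re, Real.rpow_neg (hu z).le,
      Real.rpow_neg (rowNormSq_pos g z).le] at h
    have h1 := Real.rpow_pos_of_pos (hu z) (1 + (k : ℝ) / 2)
    have h2 := Real.rpow_pos_of_pos (rowNormSq_pos g z) (1 + (k : ℝ) / 2)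
    rw [Real.div_rpow (hu z).le (rowNormSq_pos g z).le, div_eq_mul_inv, h]
    field_simp
  -- The ratio in `hnorm` is bounded, so the entire function `q` is bounded and Liouville's theorem
  -- makes it constant.
  have hconst : ∀ z w, q.eval z = q.eval w := by
    intro z w
    refine q.differentiable.apply_eq_apply_of_bounded ?_ z w
    rw [isBounded_iff_forall_norm_le]
    refine ⟨(‖g.1 0 0‖ ^ 2 + ‖g.1 0 1‖ ^ 2 + ‖g.1 1 0‖ ^ 2 + ‖g.1 1 1‖ ^ 2)
      ^ (1 + (k : ℝ) / 2), ?_⟩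
    rintro _ ⟨x, rfl⟩
    have h := hnorm ((starRingEnd ℂ) x)
    rw [Complex.conj_conj] at h
    change ‖q.eval x‖ ≤ _
    rw [h]
    exact Real.rpow_le_rpow (div_nonneg (hu _).le (rowNormSq_pos g _).le)
      ((div_le_iff₀ (rowNormSq_pos g _)).mpr (one_add_norm_sq_le g _)) hr.le
  -- With `q` constant, the ratio equals its value `1 / rowNormSq g 0` at the origin.
  refine mem_specialUnitaryGroup_of_rowNormSq (c := rowNormSq g 0) fun z => ?_
  have h := hnorm z
  rw [hconst _ ((starRingEnd ℂ) 0), hnorm 0] at h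
  have h5 := (Real.rpow_left_inj (div_nonneg (hu _).le (rowNormSq_pos g _).le)
    (div_nonneg (hu _).le (rowNormSq_pos g _).le) hr.ne').mp h
  rw [div_eq_div_iff (rowNormSq_pos g _).ne' (rowNormSq_pos g _).ne'] at h5
  simp only [norm_zero] at h5
  linarith

/-- An element of `SU(2)` that acts on the lowest subspace by a scalar is `±1`. -/
theorem eq_one_or_eq_neg_one_of_forall_eq_smul {k : ℕ} (hk : 1 ≤ k) (ρ : ℝ) {g : SL2C}
    (hg : (g : Matrix (Fin 2) (Fin 2) ℂ) ∈ Matrix.specialUnitaryGroup (Fin 2) ℂ) {c : ℂ}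
    (hc : ∀ f ∈ lowestSubspace k ρ, principalSeries k ρ g f = c • f) :
    (g : Matrix (Fin 2) (Fin 2) ℂ) = 1 ∨ (g : Matrix (Fin 2) (Fin 2) ℂ) = -1 := by
  -- The scalar action is tested on the monomials; since `g` is unitary, the same weight appears on
  -- both sides and cancels.
  have key : ∀ m ≤ k, ∀ z : ℂ, (starRingEnd ℂ) (g.1 0 0 * z + g.1 1 0) ^ m
      * (starRingEnd ℂ) (denom g z) ^ (k - m) = c * (starRingEnd ℂ) z ^ m := by
    intro m hm
    have hp : (Polynomial.X ^ m : Polynomial ℂ).natDegree ≤ k := by simpa using hm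
    have h := hc _ (lowestVec_mem k ρ hp)
    refine congrFun ((Continuous.ae_eq_iff_eq volume ?_ ?_).mp ?_)
    · unfold denom
      have := Complex.continuous_conj
      fun_prop
    · have := Complex.continuous_conj
      fun_prop
    · have h' := principalSeries_lowestVec k ρ g hp
      rw [h] at h'
      filter_upwards [h', Lp.coeFn_smul c (lowestVec k ρ _ hp), coeFn_lowestVec k ρ hp,
        ae_regular g] with z h1 h2 h3 hz
      rw [h2, Pi.smul_apply, h3, denom_pow_mul_eval_moebius g hp hz,
        rowNormSq_of_mem_specialUnitaryGroup hg, ← weight, smul_eq_mul, ← mul_assoc] at h1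
      have h4 := mul_right_cancel₀ (weight_ne_zero k ρ z) h1
      simp only [Polynomial.eval_pow, Polynomial.eval_X, Polynomial.coeff_X_pow, ite_mul, one_mul,
        zero_mul] at h4
      rw [Finset.sum_ite_eq' (Finset.range (k + 1)) m,
        if_pos (Finset.mem_range.mpr (Nat.lt_succ_iff.mpr hm))] at h4
      exact h4.symm
  have hk0 : k ≠ 0 := by omega
  have h0 : ∀ z : ℂ, (starRingEnd ℂ) (denom g z) ^ k = c := by
    intro z
    simpa using key 0 (Nat.zero_le k) z
  -- Otherwise `denom g` takes the values 0 and 1, whose `k`-th powers differ because `k ≥ 1`.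
  have hb : g.1 0 1 = 0 := by
    by_contra hb
    have h1 := h0 (-g.1 1 1 / g.1 0 1)
    have h2 := h0 ((1 - g.1 1 1) / g.1 0 1)
    rw [denom, mul_div_cancel₀ _ hb] at h1 h2
    rw [neg_add_cancel, map_zero, zero_pow hk0] at h1
    rw [sub_add_cancel, map_one, one_pow, ← h1] at h2
    exact one_ne_zero h2
  have hc' : g.1 1 0 = 0 := by
    have h1 := key k le_rfl 0
    simp only [mul_zero, zero_add, Nat.sub_self, pow_zero, mul_one, map_zero,
      zero_pow hk0] at h1
    simpa using pow_eq_zero_iff hk0 |>.mp h1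
  have hdet := det_eq g
  rw [hb, zero_mul, sub_zero] at hdet
  have hd : (starRingEnd ℂ) (g.1 1 1) ≠ 0 := by
    intro h
    rw [map_eq_zero] at h
    simp [h] at hdet
  -- For the now diagonal `g`, `m = 0` and `m = 1` give the same scalar as `conj d ^ k` and `conj a
  -- * conj d ^ (k - 1)`.
  have had : g.1 0 0 = g.1 1 1 := by
    have h1 := key 1 hk 1
    rw [← h0 1] at h1
    simp only [denom, hb, hc', mul_one, add_zero, zero_add, pow_one, map_one] at h1
    rw [← Nat.sub_add_cancel hk, pow_succ', Nat.add_sub_cancel] at h1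
    exact (starRingEnd ℂ).injective (mul_right_cancel₀ (pow_ne_zero _ hd) h1)
  have hsq : g.1 1 1 ^ 2 = 1 := by
    rw [had] at hdet
    linear_combination hdet
  rcases sq_eq_sq_iff_eq_or_eq_neg.mp (hsq.trans (one_pow 2).symm) with h | h
  · left
    ext i j
    fin_cases i <;> fin_cases j <;> simp [had, hb, hc', h]
  · right
    ext i j
    fin_cases i <;> fin_cases j <;> simp [had, hb, hc', h]

theorem principalSeries_of_coe_eq_neg_one (k : ℕ) (ρ : ℝ) {g : SL2C}
    (hg : (g : Matrix (Fin 2) (Fin 2) ℂ) = -1) (f : L2C) :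
    principalSeries k ρ g f = (-1 : ℂ) ^ k • f := by
  apply Lp.ext
  filter_upwards [coeFn_principalSeries k ρ g f, Lp.coeFn_smul ((-1 : ℂ) ^ k) f] with z h1 h2
  rw [h1, h2, Pi.smul_apply, smul_eq_mul, actFun]
  have hd : denom g z = -1 := by simp [denom, hg]
  have hm : moebius g z = z := by simp [moebius, hd, hg]
  rw [hd, hm, character]
  simp

/-! ### The face amplitude: bound and equality case. -/

theorem InternalFace.amplitude_eq {V H : Type*} {𝒢 : HalfEdgeGraph V H} (h : InternalFace 𝒢)
    (k : ℕ) (ρ : ℝ) (g : H → SL2C) :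
    h.amplitude k ρ g = (k + 1) * hilbertTrace
      (((List.ofFn (h.wedge g)).map (principalSeries k ρ)).map
        (compression (lowestSubspace k ρ))).prod := by
  rw [amplitude, List.map_map, List.map_ofFn]
  rfl

end Spinfoam

theorem mainTheorem3 {V H : Type*} {𝒢 : Spinfoam.HalfEdgeGraph V H} (h : Spinfoam.InternalFace 𝒢)
    (k : ℕ) (hk : 1 ≤ k) (ρ : ℝ) (g : H → Spinfoam.SL2C) :
    ‖h.amplitude k ρ g‖ ≤ ((k : ℝ) + 1) ^ 2 ∧
    (‖h.amplitude k ρ g‖ = ((k : ℝ) + 1) ^ 2 ↔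
      (∀ i, (h.wedge g i : Matrix (Fin 2) (Fin 2) ℂ) ∈ Matrix.specialUnitaryGroup (Fin 2) ℂ) ∧
      ((h.holonomy g : Matrix (Fin 2) (Fin 2) ℂ) = 1 ∨
        (h.holonomy g : Matrix (Fin 2) (Fin 2) ℂ) = -1)) := by
  open Spinfoam in
  set K := lowestSubspace k ρ
  set l := (List.ofFn (h.wedge g)).map (principalSeries k ρ) with hl
  set T := (l.map (compression K)).prod
  have hl0 : l ≠ [] := by simp [hl]
  have hlmem : ∀ U ∈ l, ∃ i, principalSeries k ρ (h.wedge g i) = U := by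
    intro U hU
    obtain ⟨w, hw, rfl⟩ := List.mem_map.mp hU
    obtain ⟨i, rfl⟩ := List.mem_ofFn.mp hw
    exact ⟨i, rfl⟩
  have hprod : l.prod = principalSeries k ρ (h.holonomy g) := by
    rw [InternalFace.holonomy, map_list_prod]
  have hT : T ∘L K.starProjection = T := prod_compression_comp_starProjection K l hl0
  have hn : ∀ x, ‖T x‖ ≤ ‖x‖ := norm_prod_compression_apply_le K l
  have hrank : Module.finrank ℂ K = k + 1 := finrank_lowestSubspace k ρ
  have hk1 : (0 : ℝ) < (k : ℝ) + 1 := by positivity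
  have hamp : ‖h.amplitude k ρ g‖ = ((k : ℝ) + 1) * ‖hilbertTrace T‖ := by
    rw [InternalFace.amplitude_eq, norm_mul]
    congr 1
    exact_mod_cast Complex.norm_natCast (k + 1)
  have hle : ‖hilbertTrace T‖ ≤ (k : ℝ) + 1 := by
    have := norm_hilbertTrace_le K hT hn
    rw [hrank] at this
    exact_mod_cast this
  refine ⟨by rw [hamp, sq]; gcongr, ?_⟩
  rw [hamp, sq, mul_right_inj' hk1.ne']
  constructor
  · intro heq
    obtain ⟨c, hc, hTc⟩ := eq_smul_of_norm_hilbertTrace_eq K hT hn (by omega)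
      (by rw [heq, hrank]; push_cast; rfl)
    -- A phase is isometric on `K`, so every wedge operator preserves `K`.
    have hpres := map_mem_of_norm_prod_compression l fun x hx => by
      change ‖T x‖ = ‖x‖
      rw [hTc x hx, norm_smul, hc, one_mul]
    have hsu : ∀ i, (h.wedge g i : Matrix (Fin 2) (Fin 2) ℂ)
        ∈ Matrix.specialUnitaryGroup (Fin 2) ℂ := fun i =>
      mem_specialUnitaryGroup_of_forall_mem k ρ (hpres _ (List.mem_map_of_mem (List.mem_ofFn.mpr ⟨i, rfl⟩)))
    -- The projections are now inactive on `K`, so the holonomy itself acts there by the phase `c`.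
    have hact : ∀ x ∈ K, principalSeries k ρ (h.holonomy g) x = c • x ∧
        principalSeries k ρ (h.holonomy g) x ∈ K := by
      intro x hx
      obtain ⟨h1, h2⟩ := prod_compression_apply l hpres hx
      rw [hprod] at h1 h2
      exact ⟨h1.symm.trans (hTc x hx), h2⟩
    exact ⟨hsu, eq_one_or_eq_neg_one_of_forall_eq_smul hk ρ
      (mem_specialUnitaryGroup_of_forall_mem k ρ fun x hx => (hact x hx).2)
      fun x hx => (hact x hx).1⟩
  · rintro ⟨hsu, hhol⟩
    have hpres : ∀ U ∈ l, ∀ x ∈ K, U x ∈ K := by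
      intro U hU x hx
      obtain ⟨i, rfl⟩ := hlmem U hU
      exact principalSeries_mem_lowestSubspace k ρ (hsu i) hx
    -- The holonomy `-1` acts by `(-1) ^ k`; the modulus of the trace does not see this sign.
    have hscalar : ∃ c : ℂ, ‖c‖ = 1 ∧ ∀ x, principalSeries k ρ (h.holonomy g) x = c • x := by
      rcases hhol with h1 | h1
      · refine ⟨1, norm_one, fun x => ?_⟩
        have : h.holonomy g = 1 := Subtype.ext h1
        rw [this, map_one, one_smul]
        rfl
      · exact ⟨(-1) ^ k, by simp, principalSeries_of_coe_eq_neg_one k ρ h1⟩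
    obtain ⟨c, hc, hx⟩ := hscalar
    rw [hilbertTrace_of_eq_smul K hT (c := c) fun x hxK => by
      rw [← hx x, ← hprod]; exact (prod_compression_apply l hpres hxK).1]
    rw [norm_mul, hc, hrank, Complex.norm_natCast]
    push_cast
    ring
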